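/- Let $\Bbbk$ be a field and $A$ a finite-dimensional unital associative $\Bbbk$-algebra; for a finite-dimensional algebra $R$ write $R\text{-mod}$ for the category of finitely generated left $R$-modules. All endofunctors are additive and $\Bbbk$-linear; an endofunctor $F$ is called selfadjoint if it is adjoint to itself, and selfadjoint endofunctors form a category whose morphisms are all natural transformations. Let $X\in A\text{-mod}$ be projective and injective, put $B=\mathrm{End}_A(X)^{\mathrm{op}}$, let $\mathrm{add}(X)$ be the class of direct summands of finite direct sums of copies of $X$, and let $\mathcal X$ be the full subcategory of $A\text{-mod}$ of all $Y$ that admit an exact sequence $X_1\to X_0\to Y\to 0$ with $X_0,X_1\in\mathrm{add}(X)$. Let $\Phi=\mathrm{Hom}_A(X,-):\mathcal X\to B\text{-mod}$. Assume that $A$ has the double centralizer property for $X$, i.e. that there is an exact sequence $0\to {}_AA\to X_0\to X_1$ with $X_0,X_1\in\mathrm{add}(X)$. Then $\Phi$ is an equivalence; every selfadjoint endofunctor $F$ of $A\text{-mod}$ maps $\mathcal X$ to $\mathcal X$; the endofunctor $\overline F:=\Phi\circ F|_{\mathcal X}\circ\Phi^{-1}$ of $B\text{-mod}$ is selfadjoint;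 and the functor $F\mapsto\overline F$, $\xi\mapsto\overline\xi:=\Phi\,\xi|_{\mathcal X}\,\Phi^{-1}$, from the category of selfadjoint endofunctors of $A\text{-mod}$ to the category of selfadjoint endofunctors of $B\text{-mod}$ is full and faithful. -/

import Mathlib

open CategoryTheory

universe w u

namespace SelfadjointRestriction

noncomputable section

/-- An additive and `k`-linear endofunctor `F` of a `k`-linear category is selfadjoint if it is
adjoint to itself. -/
def IsSelfadjoint (k : Type*) [CommRing k] {C : Type*} [Category C] [Preadditive C] [Linear k C] :
    ObjectProperty (C ⥤ C) := fun F =>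
  ∃ _ : F.Additive, F.Linear k ∧ Nonempty (F ⊣ F)

/-- The category of selfadjoint (additive, `k`-linear) endofunctors of `C`;
the morphisms are all natural transformations. -/
abbrev SelfadjointEndofunctor (k : Type*) [CommRing k] (C : Type*) [Category C] [Preadditive C]
    [Linear k C] :=
  (IsSelfadjoint k (C := C)).FullSubcategory

/-- The restriction of an endofunctor to a full subcategory that it preserves. -/
abbrev restrict {C : Type*} [Category C] (P : ObjectProperty C) (F : C ⥤ C)
    (hF : ∀ Y, P Y → P (F.obj Y)) : P.FullSubcategory ⥤ P.FullSubcategory :=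
  P.lift (P.ι ⋙ F) fun Y => hF Y.obj Y.property

/-- The restriction of a natural transformation to a preserved full subcategory. -/
abbrev restrictMap {C : Type*} [Category C] (P : ObjectProperty C) {F G : C ⥤ C}
    (hF : ∀ Y, P Y → P (F.obj Y)) (hG : ∀ Y, P Y → P (G.obj Y)) (ξ : F ⟶ G) :
    restrict P F hF ⟶ restrict P G hG where
  app Y := ObjectProperty.homMk (ξ.app Y.obj)
  naturality _ _ f := ObjectProperty.hom_ext _ (ξ.naturality f.hom)

section Modules

variable {A : Type u} [Ring A]

/-- `add(X)`: the modules that are direct summands of finite direct sums of copies of `X`. -/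
def addClosure (X : FGModuleCat.{u} A) : ObjectProperty (FGModuleCat.{u} A) := fun Y =>
  ∃ (n : ℕ) (i : Y →ₗ[A] (Fin n → X)) (p : (Fin n → X) →ₗ[A] Y), p ∘ₗ i = LinearMap.id

/-- The modules `Y` that have a presentation `X₁ → X₀ → Y → 0` (exact) with `X₀, X₁` in `add(X)`. -/
def presentedBy (X : FGModuleCat.{u} A) : ObjectProperty (FGModuleCat.{u} A) := fun Y =>
  ∃ X₁ X₀ : FGModuleCat.{u} A, addClosure X X₁ ∧ addClosure X X₀ ∧
    ∃ (f : X₁ →ₗ[A] X₀) (g : X₀ →ₗ[A] Y), Function.Exact f g ∧ Function.Surjective g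

/-- `A` has the double centralizer property for `X`: there is an exact sequence
`0 → A → X₀ → X₁` of left `A`-modules with `X₀, X₁` in `add(X)`. -/
def HasDoubleCentralizerProperty (X : FGModuleCat.{u} A) : Prop :=
  ∃ X₀ X₁ : FGModuleCat.{u} A, addClosure X X₀ ∧ addClosure X X₁ ∧
    ∃ (ι : A →ₗ[A] X₀) (α : X₀ →ₗ[A] X₁), Function.Injective ι ∧ Function.Exact ι α

/-- The algebra `B = End_A(X)ᵒᵖ`. Multiplication in `End X` is composition of maps. -/
abbrev OppositeEnd (X : FGModuleCat.{u} A) : Type u := (End X)ᵐᵒᵖ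

open scoped ModuleCat in
/-- `Hom_A(X, Y)` is finitely generated over `B = End_A(X)ᵒᵖ`. -/
theorem finite_hom (k : Type w) [Field k] [Algebra k A] [Module.Finite k A]
    (X Y : FGModuleCat.{u} A) : Module.Finite (OppositeEnd X) (X ⟶ Y) := by
  have hX : Module.Finite k X.obj := Module.Finite.trans A X.obj
  have hY : Module.Finite k Y.obj := Module.Finite.trans A Y.obj
  have hXY : Module.Finite k (X ⟶ Y) :=
    Module.Finite.of_injective
      ({ toFun := fun (f : X ⟶ Y) => f.hom.hom.restrictScalars k
         map_add' := fun _ _ => rfl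
         map_smul' := fun _ _ => rfl } : (X ⟶ Y) →ₗ[k] (X.obj →ₗ[k] Y.obj))
      (fun f g h => FGModuleCat.hom_ext (LinearMap.restrictScalars_injective k h))
  have : IsScalarTower k (OppositeEnd X) (X ⟶ Y) :=
    ⟨fun c b f => Linear.smul_comp _ _ _ c b.unop f⟩
  exact Module.Finite.of_restrictScalars_finite k (OppositeEnd X) (X ⟶ Y)

variable (k : Type w) [Field k] [Algebra k A] [Module.Finite k A]

/-- The functor `Hom_A(X, -)` from `A-mod` to `B-mod`, `B = End_A(X)ᵒᵖ`; the action of `b` in `B`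
on a homomorphism is precomposition with `b`. -/
def homFunctor (X : FGModuleCat.{u} A) : FGModuleCat.{u} A ⥤ FGModuleCat.{u} (OppositeEnd X) :=
  (ModuleCat.isFG (OppositeEnd X)).lift (preadditiveCoyonedaObj X) (finite_hom k X)

/-- `Φ`: the functor `Hom_A(X, -)` on the modules presented by `add(X)`. -/
def presentedHomFunctor (X : FGModuleCat.{u} A) :
    (presentedBy X).FullSubcategory ⥤ FGModuleCat.{u} (OppositeEnd X) :=
  (presentedBy X).ι ⋙ homFunctor k X

/-- `F̄ = Φ F Φ⁻¹`: the endofunctor of `B-mod` induced by an endofunctor `F` of `A-mod` which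
preserves the modules presented by `add(X)`, when `Φ` is an equivalence. -/
def bar (X : FGModuleCat.{u} A) [(presentedHomFunctor k X).IsEquivalence]
    (F : FGModuleCat.{u} A ⥤ FGModuleCat.{u} A)
    (hF : ∀ Y, presentedBy X Y → presentedBy X (F.obj Y)) :
    FGModuleCat.{u} (OppositeEnd X) ⥤ FGModuleCat.{u} (OppositeEnd X) :=
  (presentedHomFunctor k X).inv ⋙ restrict (presentedBy X) F hF ⋙ presentedHomFunctor k X

/-- `ξ̄ = Φ ξ Φ⁻¹` for a natural transformation `ξ : F ⟶ G`. -/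
def barMap (X : FGModuleCat.{u} A) [(presentedHomFunctor k X).IsEquivalence]
    {F G : FGModuleCat.{u} A ⥤ FGModuleCat.{u} A}
    (hF : ∀ Y, presentedBy X Y → presentedBy X (F.obj Y))
    (hG : ∀ Y, presentedBy X Y → presentedBy X (G.obj Y)) (ξ : F ⟶ G) :
    bar k X F hF ⟶ bar k X G hG :=
  Functor.whiskerLeft (presentedHomFunctor k X).inv
    (Functor.whiskerRight (restrictMap (presentedBy X) hF hG ξ) (presentedHomFunctor k X))

/-- The functor `F ↦ F̄` from selfadjoint endofunctors of `A-mod` to selfadjoint endofunctors of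
`B-mod`, defined as soon as `Φ` is an equivalence, selfadjoint endofunctors `F` of `A-mod` preserve
the modules presented by `add(X)`, and the induced endofunctors `F̄` of `B-mod` are selfadjoint. -/
def barFunctor (X : FGModuleCat.{u} A) [(presentedHomFunctor k X).IsEquivalence]
    (hpres : ∀ F : SelfadjointEndofunctor k (FGModuleCat.{u} A),
      ∀ Y, presentedBy X Y → presentedBy X (F.obj.obj Y))
    (hself : ∀ F : SelfadjointEndofunctor k (FGModuleCat.{u} A),
      IsSelfadjoint k (bar k X F.obj (hpres F))) :
    SelfadjointEndofunctor k (FGModuleCat.{u} A) ⥤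
      SelfadjointEndofunctor k (FGModuleCat.{u} (OppositeEnd X)) where
  obj F := ⟨bar k X F.obj (hpres F), hself F⟩
  map {F G} ξ := ObjectProperty.homMk (barMap k X (hpres F) (hpres G) ξ.hom)
  map_id F := by
    ext Y : 3
    exact (presentedHomFunctor k X).map_id _
  map_comp ξ η := by
    ext Y : 3
    exact (presentedHomFunctor k X).map_comp _ _

end Modules

end

end SelfadjointRestriction

/-! A selfadjoint `F` is both a left and a right adjoint, so it is exact and preserves projectives
and injectives. Since `A` embeds into an object of `add(X)`, every projective-injective module lies
in `add(X)` (`isSummand_of_projective_of_injective`). Hence `F X` does, and `F` preserves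
presentations by `add(X)`. That `Φ` is an equivalence uses only projectivity of `X`; the adjunction
of `F` with itself then restricts and is conjugated by `Φ`.

Full faithfulness reduces to restricting transformations `F ⟶ G` to the presented modules. By right
exactness of `F` a transformation is determined by its component at `A`, and by left exactness of
`G` this embeds into the component at `X₀` (`natTrans_eq_of_app_eq`). Conversely, exactness of `0 →
A → X₀ → X₁` yields a component at `A` by passing to kernels; injectivity of `X` makes it natural,
and right exactness of `F` extends it to all modules (`exists_natTrans_extending`). -/

namespace SelfadjointRestriction

open Limits

section Abelian

universe v u'

variable {C : Type u'} [Category.{v} C] [Abelian C]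

/-! ### Summands and presentations in an abelian category -/

/-- `Y` is a direct summand of a finite direct sum of copies of `X`. -/
def IsSummand (X Y : C) : Prop :=
  ∃ (n : ℕ) (u : Fin n → (Y ⟶ X)) (v : Fin n → (X ⟶ Y)), ∑ i, u i ≫ v i = 𝟙 Y

theorem IsSummand.of_fintype {X Y : C} {ι : Type*} [Fintype ι] (u : ι → (Y ⟶ X))
    (v : ι → (X ⟶ Y)) (h : ∑ i, u i ≫ v i = 𝟙 Y) : IsSummand X Y := by
  refine ⟨Fintype.card ι, fun i => u ((Fintype.equivFin ι).symm i),
    fun i => v ((Fintype.equivFin ι).symm i), ?_⟩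
  rw [← h]
  exact (Fintype.equivFin ι).symm.sum_comp fun i => u i ≫ v i

theorem IsSummand.refl (X : C) : IsSummand X X :=
  ⟨1, fun _ => 𝟙 X, fun _ => 𝟙 X, by simp⟩

theorem IsSummand.trans {X Y Z : C} (hXY : IsSummand X Y) (hYZ : IsSummand Y Z) :
    IsSummand X Z := by
  obtain ⟨n, u, v, h⟩ := hXY
  obtain ⟨m, s, t, h'⟩ := hYZ
  refine .of_fintype (ι := Fin m × Fin n) (fun p => s p.1 ≫ u p.2) (fun p => v p.2 ≫ t p.1) ?_
  rw [Fintype.sum_prod_type, ← h']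
  refine Finset.sum_congr rfl fun i _ => ?_
  calc ∑ j, (s i ≫ u j) ≫ v j ≫ t i = s i ≫ (∑ j, u j ≫ v j) ≫ t i := by
        simp [Preadditive.sum_comp, Preadditive.comp_sum]
    _ = s i ≫ t i := by simp [h]

theorem IsSummand.map {X Y : C} (h : IsSummand X Y) (F : C ⥤ C) [F.Additive] :
    IsSummand (F.obj X) (F.obj Y) := by
  obtain ⟨n, u, v, h⟩ := h
  refine ⟨n, fun i => F.map (u i), fun i => F.map (v i), ?_⟩
  simp only [← F.map_comp, ← F.map_sum, h, F.map_id]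

attribute [local instance] Abelian.hasFiniteBiproducts

theorem isSummand_biproduct (X : C) (n : ℕ) : IsSummand X (⨁ fun _ : Fin n => X) :=
  ⟨n, fun i => biproduct.π (fun _ => X) i, fun i => biproduct.ι (fun _ => X) i,
    biproduct.total⟩

theorem IsSummand.injective {X Y : C} (h : IsSummand X Y) [Injective X] : Injective Y := by
  obtain ⟨n, u, v, h⟩ := h
  refine ⟨fun g f _ => ⟨∑ i, Injective.factorThru (g ≫ u i) f ≫ v i, ?_⟩⟩
  simp only [Preadditive.comp_sum, Injective.comp_factorThru_assoc, Category.assoc]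
  rw [← Preadditive.comp_sum, h, Category.comp_id]

/-- Morphisms out of a summand of copies of `X` are detected on `X`, also after applying an
additive functor. -/
theorem IsSummand.eq_zero {D : Type*} [Category D] [Preadditive D] {X Y : C}
    (h : IsSummand X Y) (F : C ⥤ D) [F.Additive] {Z : D} {t : F.obj Y ⟶ Z}
    (ht : ∀ y : X ⟶ Y, F.map y ≫ t = 0) : t = 0 := by
  obtain ⟨n, u, v, h⟩ := h
  rw [← Category.id_comp t, ← F.map_id, ← h, F.map_sum, Preadditive.sum_comp]
  exact Finset.sum_eq_zero fun i _ => by rw [F.map_comp, Category.assoc, ht, comp_zero]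

/-- `Y` is the cokernel of a morphism between summands of finite direct sums of copies of `X`. -/
def IsPresented (X Y : C) : Prop :=
  ∃ X₁ X₀ : C, IsSummand X X₁ ∧ IsSummand X X₀ ∧
    ∃ (f : X₁ ⟶ X₀) (g : X₀ ⟶ Y) (w : f ≫ g = 0), (ShortComplex.mk f g w).Exact ∧ Epi g

theorem IsSummand.isPresented {X Y : C} (h : IsSummand X Y) : IsPresented X Y :=
  ⟨Y, Y, h, h, 0, 𝟙 Y, by simp, (ShortComplex.exact_iff_mono _ rfl).2 (by dsimp; infer_instance),
    inferInstance⟩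

theorem IsPresented.map {X Y : C} (h : IsPresented X Y) (F : C ⥤ C) [F.Additive]
    [PreservesFiniteColimits F] (hF : IsSummand X (F.obj X)) : IsPresented X (F.obj Y) := by
  obtain ⟨X₁, X₀, h₁, h₀, f, g, w, hfg, hg⟩ := h
  exact ⟨F.obj X₁, F.obj X₀, hF.trans (h₁.map F), hF.trans (h₀.map F), F.map f, F.map g,
    by rw [← F.map_comp, w, F.map_zero],
    hfg.map_of_epi_of_preservesCokernel F hg inferInstance, inferInstance⟩

theorem exists_desc_of_exact {X Y Z W : C} {f : X ⟶ Y} {g : Y ⟶ Z} {w : f ≫ g = 0}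
    (h : (ShortComplex.mk f g w).Exact) [hg : Epi g] (F : C ⥤ C) [F.Additive]
    [PreservesFiniteColimits F] (t : F.obj Y ⟶ W) (ht : F.map f ≫ t = 0) :
    ∃ s : F.obj Z ⟶ W, F.map g ≫ s = t := by
  have hF := h.map_of_epi_of_preservesCokernel F hg inferInstance
  have : Epi ((ShortComplex.mk f g w).map F).g := inferInstanceAs (Epi (F.map g))
  exact ⟨hF.desc t ht, hF.g_desc t ht⟩

theorem exists_lift_of_exact {X Y Z W : C} {f : X ⟶ Y} {g : Y ⟶ Z} {w : f ≫ g = 0}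
    (h : (ShortComplex.mk f g w).Exact) [hf : Mono f] (F : C ⥤ C) [F.Additive]
    [PreservesFiniteLimits F] (t : W ⟶ F.obj Y) (ht : t ≫ F.map g = 0) :
    ∃ s : W ⟶ F.obj X, s ≫ F.map f = t := by
  have hF := h.map_of_mono_of_preservesKernel F hf inferInstance
  have : Mono ((ShortComplex.mk f g w).map F).f := inferInstanceAs (Mono (F.map f))
  exact ⟨hF.lift t ht, hF.lift_f t ht⟩

/-- Every element of `Hom(Hom(X, Y), Hom(X, Z))` compatible with endomorphisms of `X` is given by
composition with a morphism `Y ⟶ Z`, if `Y` is presented by the projective object `X`. -/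
theorem IsPresented.exists_comp_eq {X Y Z : C} [Projective X] (hY : IsPresented X Y)
    (h : (X ⟶ Y) →+ (X ⟶ Z)) (hh : ∀ (b : X ⟶ X) (x : X ⟶ Y), h (b ≫ x) = b ≫ h x) :
    ∃ t : Y ⟶ Z, ∀ x : X ⟶ Y, x ≫ t = h x := by
  obtain ⟨X₁, X₀, h₁, ⟨n, u, v, huv⟩, f, g, w, hfg, hg⟩ := hY
  -- The sum is the only possible value of `g ≫ t`: split `𝟙 X₀` through copies of `X` and apply `h`
  -- to each piece.
  have key (x : X ⟶ X₀) : x ≫ ∑ i, u i ≫ h (v i ≫ g) = h (x ≫ g) := by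
    calc x ≫ ∑ i, u i ≫ h (v i ≫ g) = h (x ≫ (∑ i, u i ≫ v i) ≫ g) := by
          simp only [Preadditive.comp_sum, Preadditive.sum_comp, map_sum, Category.assoc]
          exact Finset.sum_congr rfl fun i _ => by
            rw [← Category.assoc, ← hh, Category.assoc]
      _ = h (x ≫ g) := by rw [huv, Category.id_comp]
  have hf : f ≫ ∑ i, u i ≫ h (v i ≫ g) = 0 := by
    refine h₁.eq_zero (𝟭 C) fun y => ?_
    rw [Functor.id_map, ← Category.assoc, key, Category.assoc, w, comp_zero, map_zero]
  obtain ⟨t, ht⟩ := exists_desc_of_exact hfg (𝟭 C) _ hf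
  refine ⟨t, fun x => ?_⟩
  rw [← Projective.factorThru_comp x g, Category.assoc, ← key]
  exact congrArg _ ht

theorem IsPresented.eq_zero {X Y Z : C} (hY : IsPresented X Y) {t : Y ⟶ Z}
    (ht : ∀ x : X ⟶ Y, x ≫ t = 0) : t = 0 := by
  obtain ⟨X₁, X₀, -, h₀, f, g, w, -, hg⟩ := hY
  rw [← cancel_epi g, comp_zero]
  exact h₀.eq_zero (𝟭 C) fun y => by rw [Functor.id_map, ← Category.assoc, ht]

/-! ### Natural transformations determined on a generator -/

/-- `P` generates: every object is a quotient of a finite direct sum of copies of `P`. -/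
def IsFiniteGenerator (P : C) : Prop :=
  ∀ Y : C, ∃ (Q : C) (q : Q ⟶ Y), IsSummand P Q ∧ Epi q

theorem IsFiniteGenerator.eq_zero {P : C} (hP : IsFiniteGenerator P) (F : C ⥤ C) [F.Additive]
    [F.PreservesEpimorphisms] {Y Z : C} {t : F.obj Y ⟶ Z}
    (ht : ∀ y : P ⟶ Y, F.map y ≫ t = 0) : t = 0 := by
  obtain ⟨Q, q, hQ, _⟩ := hP Y
  rw [← cancel_epi (F.map q), comp_zero]
  exact hQ.eq_zero F fun y => by rw [← Category.assoc, ← F.map_comp, ht]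

theorem IsFiniteGenerator.ext {P : C} (hP : IsFiniteGenerator P) (F : C ⥤ C) [F.Additive]
    [F.PreservesEpimorphisms] {Y Z : C} {s t : F.obj Y ⟶ Z}
    (h : ∀ y : P ⟶ Y, F.map y ≫ s = F.map y ≫ t) : s = t :=
  sub_eq_zero.1 (hP.eq_zero F fun y => by rw [Preadditive.comp_sub, h, sub_self])

/-- Additivity forces the component on a cover `Q` of `Y`, and right exactness of `F` lets it
descend to `Y`. Projectivity of `P` lifts each `P ⟶ Y` to `Q`, which gives compatibility. -/
theorem IsFiniteGenerator.exists_app {P : C} [Projective P] (hP : IsFiniteGenerator P)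
    (F G : C ⥤ C) [F.Additive] [G.Additive] [PreservesFiniteColimits F]
    (θ : F.obj P ⟶ G.obj P) (hθ : ∀ f : P ⟶ P, F.map f ≫ θ = θ ≫ G.map f) (Y : C) :
    ∃ t : F.obj Y ⟶ G.obj Y, ∀ y : P ⟶ Y, F.map y ≫ t = θ ≫ G.map y := by
  obtain ⟨Q, q, ⟨n, u, v, huv⟩, _⟩ := hP Y
  have hQ (y : P ⟶ Q) : F.map y ≫ ∑ i, F.map (u i) ≫ θ ≫ G.map (v i) = θ ≫ G.map y := by
    calc F.map y ≫ ∑ i, F.map (u i) ≫ θ ≫ G.map (v i)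
        = θ ≫ G.map (y ≫ ∑ i, u i ≫ v i) := by
          simp only [Preadditive.comp_sum, G.map_sum]
          refine Finset.sum_congr rfl fun i _ => ?_
          rw [← Category.assoc, ← F.map_comp, ← Category.assoc, hθ, Category.assoc,
            ← G.map_comp, Category.assoc]
      _ = θ ≫ G.map y := by rw [huv, Category.comp_id]
  -- The kernel of `q` need not be a summand of copies of `P`, but vanishing on its image under `F`
  -- can still be tested on morphisms from `P`.
  obtain ⟨t, ht⟩ := exists_desc_of_exact (ShortComplex.exact_kernel q) F
    ((∑ i, F.map (u i) ≫ θ ≫ G.map (v i)) ≫ G.map q) <| hP.eq_zero F fun y => by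
      rw [← F.map_comp_assoc, ← Category.assoc, hQ, Category.assoc, ← G.map_comp,
        Category.assoc, kernel.condition, comp_zero, G.map_zero, comp_zero]
  refine ⟨t, fun y => ?_⟩
  rw [← Projective.factorThru_comp y q, F.map_comp, Category.assoc, ht, G.map_comp,
    ← Category.assoc θ, ← hQ, Category.assoc]

/-- A natural transformation out of a right exact functor can be prescribed on a projective
generator. -/
theorem IsFiniteGenerator.exists_natTrans {P : C} [Projective P] (hP : IsFiniteGenerator P)
    (F G : C ⥤ C) [F.Additive] [G.Additive] [PreservesFiniteColimits F]
    (θ : F.obj P ⟶ G.obj P) (hθ : ∀ f : P ⟶ P, F.map f ≫ θ = θ ≫ G.map f) :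
    ∃ ξ : F ⟶ G, ξ.app P = θ := by
  choose t ht using hP.exists_app F G θ hθ
  refine ⟨{ app := t, naturality := fun Y Z f => hP.ext F fun y => ?_ }, ?_⟩
  · rw [← F.map_comp_assoc, ht, ← Category.assoc, ht, Category.assoc, G.map_comp]
  · simpa using ht P (𝟙 P)

/-- Two natural transformations out of a right exact functor agree if they agree on `X`, where a
projective generator `P` embeds into a summand of copies of `X` and `G` preserves monomorphisms. -/
theorem natTrans_eq_of_app_eq {P X X₀ : C} (hP : IsFiniteGenerator P)
    {F G : C ⥤ C} [F.Additive] [F.PreservesEpimorphisms] [G.PreservesMonomorphisms]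
    (h₀ : IsSummand X X₀) (a : P ⟶ X₀) [Mono a] {ξ η : F ⟶ G} (h : ξ.app X = η.app X) : ξ = η := by
  have e₀ : ξ.app X₀ = η.app X₀ := by
    refine sub_eq_zero.1 (h₀.eq_zero F fun y => ?_)
    rw [Preadditive.comp_sub, ξ.naturality, η.naturality, h, sub_self]
  have eP : ξ.app P = η.app P := by
    rw [← cancel_mono (G.map a), ← ξ.naturality, ← η.naturality, e₀]
  ext Y
  exact hP.ext F fun y => by rw [ξ.naturality, η.naturality, eP]

/-- A natural transformation between the restrictions of exact functors to the objects presented by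
an injective object `X` extends to all objects, if a projective generator `P` is the kernel of a
morphism between summands of copies of `X`. -/
theorem exists_natTrans_extending {P X X₀ X₁ : C} [Projective P] (hP : IsFiniteGenerator P)
    [Injective X] (h₀ : IsSummand X X₀) (h₁ : IsSummand X X₁) (a : P ⟶ X₀) [Mono a]
    (α : X₀ ⟶ X₁) (w : a ≫ α = 0) (hex : (ShortComplex.mk a α w).Exact)
    (F G : C ⥤ C) [F.Additive] [G.Additive] [PreservesFiniteColimits F] [PreservesFiniteLimits G]
    (ζ : ∀ Y, IsPresented X Y → (F.obj Y ⟶ G.obj Y))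
    (hζ : ∀ Y Z (hY : IsPresented X Y) (hZ : IsPresented X Z) (f : Y ⟶ Z),
      F.map f ≫ ζ Z hZ = ζ Y hY ≫ G.map f) :
    ∃ ξ : F ⟶ G, ∀ Y hY, ξ.app Y = ζ Y hY := by
  -- `G P` is the kernel of `G.map α`, so this lift is the forced component at `P`.
  obtain ⟨θ, hθ⟩ := exists_lift_of_exact hex G (F.map a ≫ ζ X₀ h₀.isPresented) <| by
    rw [Category.assoc, ← hζ X₀ X₁ _ h₁.isPresented, ← F.map_comp_assoc, w, F.map_zero, zero_comp]
  -- Since `Y` is injective, `x` extends along `a` to `X₀`, where `ζ` is natural.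
  have hθ' {Y : C} (hY : IsSummand X Y) (x : P ⟶ Y) :
      F.map x ≫ ζ Y hY.isPresented = θ ≫ G.map x := by
    have := hY.injective
    rw [← Injective.comp_factorThru x a, F.map_comp, G.map_comp, Category.assoc,
      hζ X₀ Y h₀.isPresented, ← Category.assoc, ← hθ, Category.assoc]
  obtain ⟨ξ, hξ⟩ := hP.exists_natTrans F G θ fun f => by
    rw [← cancel_mono (G.map a), Category.assoc, Category.assoc, hθ, ← F.map_comp_assoc,
      hθ' h₀, G.map_comp]
  refine ⟨ξ, fun Y hY => ?_⟩
  obtain ⟨Y₁, Y₀, -, hY₀, f, g, -, -, _⟩ := id hY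
  rw [← cancel_epi (F.map g), hζ Y₀ Y hY₀.isPresented, ξ.naturality]
  congr 1
  exact hP.ext F fun y => by rw [ξ.naturality, hξ, hθ' hY₀]

/-- A projective and injective object is a summand of copies of `X`, if a projective generator
embeds into a summand of copies of `X`. -/
theorem isSummand_of_projective_of_injective {P X X₀ Y : C} (hP : IsFiniteGenerator P)
    (h₀ : IsSummand X X₀) (a : P ⟶ X₀) [Mono a] [Projective Y] [Injective Y] :
    IsSummand X Y := by
  obtain ⟨Q, q, ⟨n, u, v, huv⟩, _⟩ := hP Y
  let s : Y ⟶ Q := Projective.factorThru (𝟙 Y) q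
  have hs : s ≫ q = 𝟙 Y := Projective.factorThru_comp _ _
  -- Projectivity splits `Y` off `Q`, which embeds into copies of `P` and thus of `X₀`; injectivity
  -- of `Y` then splits `j`.
  let j : Y ⟶ ⨁ fun _ : Fin n => X₀ := biproduct.lift fun i => s ≫ u i ≫ a
  have : Mono j := Preadditive.mono_of_cancel_zero _ fun {W} t ht => by
    have hu (i : Fin n) : (t ≫ s) ≫ u i = 0 := by
      rw [← cancel_mono a, zero_comp]
      simpa [j] using congrArg (· ≫ biproduct.π (fun _ : Fin n => X₀) i) ht
    rw [← Category.comp_id t, ← hs, ← Category.assoc, ← Category.comp_id (t ≫ s), ← huv,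
      Preadditive.comp_sum,
      Finset.sum_eq_zero fun i _ => by rw [← Category.assoc, hu, zero_comp], zero_comp]
  refine (h₀.trans (isSummand_biproduct X₀ n)).trans
    ⟨1, fun _ => j, fun _ => Injective.factorThru (𝟙 Y) j, ?_⟩
  simp

/-! ### Realising modules over the opposite endomorphism ring -/

/-- Every finitely generated left module over `End(X)ᵒᵖ` is of the form `Hom(X, Y)` with `Y`
presented by the projective object `X`. -/
theorem exists_isPresented_linearEquiv (X : C) [Projective X]
    (hX : ∀ Y : C, IsNoetherian (End X)ᵐᵒᵖ (X ⟶ Y))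
    (M : Type*) [AddCommGroup M] [Module (End X)ᵐᵒᵖ M] [Module.Finite (End X)ᵐᵒᵖ M] :
    ∃ Y : C, IsPresented X Y ∧ Nonempty ((X ⟶ Y) ≃ₗ[(End X)ᵐᵒᵖ] M) := by
  have smul_def {Y : C} (b : (End X)ᵐᵒᵖ) (x : X ⟶ Y) : b • x = b.unop ≫ x := rfl
  obtain ⟨n, m, hm⟩ := Module.Finite.exists_fin (R := (End X)ᵐᵒᵖ) (M := M)
  let X₀ : C := ⨁ fun _ : Fin n => X
  let p : (X ⟶ X₀) →ₗ[(End X)ᵐᵒᵖ] M :=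
    { toFun := fun x => ∑ i, (MulOpposite.op (x ≫ biproduct.π (fun _ => X) i) : (End X)ᵐᵒᵖ) • m i
      map_add' := fun x y => by
        simp only [Preadditive.add_comp, MulOpposite.op_add, add_smul, Finset.sum_add_distrib]
      map_smul' := fun b x => by
        simp only [RingHom.id_apply, Finset.smul_sum, smul_smul, smul_def, Category.assoc]
        rfl }
  have hp : Function.Surjective p := by
    rw [← LinearMap.range_eq_top, eq_top_iff, ← hm, Submodule.span_le]
    rintro _ ⟨i, rfl⟩
    refine ⟨biproduct.ι (fun _ => X) i, ?_⟩
    change ∑ j, (MulOpposite.op (biproduct.ι (fun _ => X) i ≫ biproduct.π (fun _ => X) j) :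
      (End X)ᵐᵒᵖ) • m j = m i
    rw [Finset.sum_eq_single i (fun j _ hj => by
      rw [biproduct.ι_π_ne _ hj.symm]; exact zero_smul _ _) (by simp), biproduct.ι_π_self]
    exact one_smul _ _
  -- The generators of the relations are themselves morphisms `X ⟶ X₀`, so they assemble into `f`.
  -- As `Hom(X, -)` is exact, the cokernel of `f` realises `M`.
  obtain ⟨l, r, hr⟩ := Submodule.fg_iff_exists_fin_generating_family.1
    ((hX X₀).noetherian (LinearMap.ker p))
  let f : (⨁ fun _ : Fin l => X) ⟶ X₀ := biproduct.desc r
  let g : X₀ ⟶ cokernel f := cokernel.π f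
  let c : (X ⟶ X₀) →ₗ[(End X)ᵐᵒᵖ] (X ⟶ cokernel f) :=
    { toFun := fun x => x ≫ g
      map_add' := fun _ _ => Preadditive.add_comp _ _ _ _ _ _
      map_smul' := fun _ _ => Category.assoc _ _ _ }
  have hc : Function.Surjective c := fun x =>
    ⟨Projective.factorThru x g, Projective.factorThru_comp x g⟩
  have hex : (ShortComplex.mk f g (cokernel.condition f)).Exact := ShortComplex.exact_cokernel f
  have hker : LinearMap.ker c = LinearMap.ker p := by
    rw [← hr]
    refine le_antisymm (fun x hx => ?_) (Submodule.span_le.2 ?_)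
    · obtain ⟨y, hy⟩ : ∃ y, y ≫ f = x :=
        ⟨hex.liftFromProjective x hx, hex.liftFromProjective_comp _ _⟩
      have : x = ∑ i, (MulOpposite.op (y ≫ biproduct.π (fun _ => X) i) : (End X)ᵐᵒᵖ) • r i := by
        conv_lhs => rw [← hy, ← Category.comp_id y, ← biproduct.total, Preadditive.comp_sum,
          Preadditive.sum_comp]
        exact Finset.sum_congr rfl fun i _ => by simp [f, smul_def]
      rw [this]
      exact Submodule.sum_mem _ fun i _ =>
        Submodule.smul_mem _ _ (Submodule.subset_span ⟨i, rfl⟩)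
    · rintro _ ⟨i, rfl⟩
      change r i ≫ g = 0
      have : r i = biproduct.ι (fun _ => X) i ≫ f := by simp [f]
      rw [this, Category.assoc, cokernel.condition, comp_zero]
  refine ⟨cokernel f, ⟨_, _, isSummand_biproduct X l, isSummand_biproduct X n, f, g, _, hex,
    inferInstance⟩, ⟨?_⟩⟩
  exact (c.quotKerEquivOfSurjective hc).symm ≪≫ₗ Submodule.quotEquivOfEq _ _ hker ≪≫ₗ
    p.quotKerEquivOfSurjective hp

end Abelian

/-! ### Translation between modules and the abelian category language -/

section Modules

variable {A : Type u} [Ring A]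

/-- A linear map between finitely generated modules as a morphism. -/
abbrev homOfLinear {X Y : FGModuleCat.{u} A} (f : X →ₗ[A] Y) : X ⟶ Y :=
  ObjectProperty.homMk (ModuleCat.ofHom f)

theorem hom_hom_sum {X Y : FGModuleCat.{u} A} {ι : Type*} (s : Finset ι) (f : ι → (X ⟶ Y)) :
    (∑ i ∈ s, f i).hom.hom = ∑ i ∈ s, (f i).hom.hom :=
  map_sum (⟨⟨fun g => g.hom.hom, rfl⟩, fun _ _ => rfl⟩ : (X ⟶ Y) →+ (X →ₗ[A] Y)) f s

theorem comp_homOfLinear_eq_zero {X Y Z : FGModuleCat.{u} A} {f : X →ₗ[A] Y} {g : Y →ₗ[A] Z}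
    (h : Function.Exact f g) : homOfLinear f ≫ homOfLinear g = 0 := by
  ext x
  exact h.apply_apply_eq_zero x

variable [IsNoetherianRing A]

theorem addClosure_iff_isSummand (X Y : FGModuleCat.{u} A) : addClosure X Y ↔ IsSummand X Y := by
  constructor
  · rintro ⟨n, i, p, h⟩
    refine ⟨n, fun j => homOfLinear (LinearMap.proj j ∘ₗ i),
      fun j => homOfLinear (p ∘ₗ LinearMap.single A (fun _ => X) j), ?_⟩
    ext y
    rw [hom_hom_sum]
    simp only [LinearMap.sum_apply]
    change ∑ j, p (Pi.single j (i y j)) = y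
    rw [← map_sum, Finset.univ_sum_single]
    exact LinearMap.congr_fun h y
  · rintro ⟨n, u, v, h⟩
    refine ⟨n, LinearMap.pi fun j => (u j).hom.hom,
      ∑ j, (v j).hom.hom ∘ₗ LinearMap.proj j, ?_⟩
    have := congrArg (fun f : Y ⟶ Y => f.hom.hom) h
    rw [hom_hom_sum] at this
    ext y
    have := LinearMap.congr_fun this y
    simpa using this

theorem exact_iff_function_exact {X Y Z : FGModuleCat.{u} A} (f : X ⟶ Y) (g : Y ⟶ Z)
    (w : f ≫ g = 0) :
    (ShortComplex.mk f g w).Exact ↔ Function.Exact f.hom.hom g.hom.hom := by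
  rw [← ShortComplex.exact_map_iff_of_faithful (ShortComplex.mk f g w)
      (forget₂ (FGModuleCat A) (ModuleCat A)),
    ShortComplex.ShortExact.moduleCat_exact_iff_function_exact]
  rfl

theorem epi_iff_surjective {X Y : FGModuleCat.{u} A} (f : X ⟶ Y) :
    Epi f ↔ Function.Surjective f.hom.hom := by
  rw [← Functor.epi_map_iff_epi (forget₂ (FGModuleCat A) (ModuleCat A)),
    ModuleCat.epi_iff_surjective]
  rfl

theorem mono_iff_injective {X Y : FGModuleCat.{u} A} (f : X ⟶ Y) :
    Mono f ↔ Function.Injective f.hom.hom := by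
  rw [← Functor.mono_map_iff_mono (forget₂ (FGModuleCat A) (ModuleCat A)),
    ModuleCat.mono_iff_injective]
  rfl

theorem presentedBy_iff_isPresented (X Y : FGModuleCat.{u} A) :
    presentedBy X Y ↔ IsPresented X Y := by
  constructor
  · rintro ⟨X₁, X₀, h₁, h₀, f, g, hfg, hg⟩
    exact ⟨X₁, X₀, (addClosure_iff_isSummand _ _).1 h₁, (addClosure_iff_isSummand _ _).1 h₀,
      homOfLinear f, homOfLinear g, comp_homOfLinear_eq_zero hfg,
      (exact_iff_function_exact _ _ _).2 hfg, (epi_iff_surjective _).2 hg⟩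
  · rintro ⟨X₁, X₀, h₁, h₀, f, g, w, hfg, hg⟩
    exact ⟨X₁, X₀, (addClosure_iff_isSummand _ _).2 h₁, (addClosure_iff_isSummand _ _).2 h₀,
      f.hom.hom, g.hom.hom, (exact_iff_function_exact _ _ _).1 hfg, (epi_iff_surjective _).1 hg⟩

theorem projective_regular : Projective (FGModuleCat.of A A) := by
  refine ⟨fun {E X} f e he => ?_⟩
  obtain ⟨h, hh⟩ := Module.projective_lifting_property e.hom.hom f.hom.hom
    ((epi_iff_surjective e).1 he)
  exact ⟨homOfLinear h, FGModuleCat.hom_ext hh⟩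

theorem isFiniteGenerator_regular : IsFiniteGenerator (FGModuleCat.of A A) := fun Y => by
  obtain ⟨n, f, hf⟩ := Module.Finite.exists_fin' A Y
  exact ⟨FGModuleCat.of A (Fin n → A), homOfLinear f,
    (addClosure_iff_isSummand _ _).1 ⟨n, LinearMap.id, LinearMap.id, rfl⟩,
    (epi_iff_surjective _).2 hf⟩

theorem HasDoubleCentralizerProperty.exists_exact {X : FGModuleCat.{u} A}
    (h : HasDoubleCentralizerProperty X) :
    ∃ (X₀ X₁ : FGModuleCat.{u} A) (a : FGModuleCat.of A A ⟶ X₀) (α : X₀ ⟶ X₁) (w : a ≫ α = 0),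
      IsSummand X X₀ ∧ IsSummand X X₁ ∧ Mono a ∧ (ShortComplex.mk a α w).Exact := by
  obtain ⟨X₀, X₁, h₀, h₁, a, α, ha, hex⟩ := h
  exact ⟨X₀, X₁, homOfLinear (X := FGModuleCat.of A A) a, homOfLinear α,
    comp_homOfLinear_eq_zero (X := FGModuleCat.of A A) hex, (addClosure_iff_isSummand _ _).1 h₀,
    (addClosure_iff_isSummand _ _).1 h₁, (mono_iff_injective _).2 ha,
    (exact_iff_function_exact _ _ _).2 hex⟩

end Modules

/-! ### The equivalence `Φ` and the induced functor -/

section Modules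

open scoped ModuleCat in
-- The Hom space is finite-dimensional over `k`, and submodules over `OppositeEnd X` are
-- `k`-subspaces.
theorem isNoetherian_hom {A : Type u} [Ring A] (k : Type w) [Field k] [Algebra k A]
    [Module.Finite k A] (X Y : FGModuleCat.{u} A) :
    IsNoetherian (OppositeEnd X) (X ⟶ Y) := by
  have hX : Module.Finite k X.obj := Module.Finite.trans A X.obj
  have hY : Module.Finite k Y.obj := Module.Finite.trans A Y.obj
  have hXY : IsNoetherian k (X ⟶ Y) :=
    isNoetherian_of_injective
      ({ toFun := fun (f : X ⟶ Y) => f.hom.hom.restrictScalars k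
         map_add' := fun _ _ => rfl
         map_smul' := fun _ _ => rfl } : (X ⟶ Y) →ₗ[k] (X.obj →ₗ[k] Y.obj))
      (fun f g h => FGModuleCat.hom_ext (LinearMap.restrictScalars_injective k h))
  have : IsScalarTower k (OppositeEnd X) (X ⟶ Y) :=
    ⟨fun c b f => Linear.smul_comp _ _ _ c b.unop f⟩
  exact isNoetherian_of_tower k hXY

variable {A : Type u} [Ring A] (k : Type w) [Field k] [Algebra k A] [Module.Finite k A]

instance (X : FGModuleCat.{u} A) : (homFunctor k X).Additive where
  map_add {_ _ f g} := by
    ext x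
    exact Preadditive.comp_add _ _ _ x f g

instance (X : FGModuleCat.{u} A) : (homFunctor k X).Linear k where
  map_smul {Y _} f r := by
    -- The scalar `r` acts on the target through the element `r • 𝟙 X` of the endomorphism ring.
    have h (x : X ⟶ Y) : x ≫ (r • f) = (r • 𝟙 X) ≫ x ≫ f := by
      rw [Linear.comp_smul, Linear.smul_comp, Category.id_comp]
    exact FGModuleCat.hom_ext (LinearMap.ext h)

instance (X : FGModuleCat.{u} A) : (presentedHomFunctor k X).Additive :=
  inferInstanceAs ((presentedBy X).ι ⋙ homFunctor k X).Additive

instance (X : FGModuleCat.{u} A) : (presentedHomFunctor k X).Linear k :=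
  inferInstanceAs (((presentedBy X).ι ⋙ homFunctor k X).Linear k)

theorem isEquivalence_presentedHomFunctor (X : FGModuleCat.{u} A) [Projective X] :
    (presentedHomFunctor k X).IsEquivalence := by
  have := IsNoetherianRing.of_finite k A
  have hf : (presentedHomFunctor k X).Faithful :=
    ⟨fun {Y Z} s t h => by
      refine ObjectProperty.hom_ext _ (sub_eq_zero.1 ?_)
      refine ((presentedBy_iff_isPresented X _).1 Y.property).eq_zero fun x => ?_
      rw [Preadditive.comp_sub]
      exact sub_eq_zero.2 (LinearMap.congr_fun (congrArg (fun φ => φ.hom.hom) h) x)⟩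
  have hfull : (presentedHomFunctor k X).Full :=
    ⟨fun {Y Z} h => by
      let h' : (X ⟶ Y.obj) →ₗ[OppositeEnd X] (X ⟶ Z.obj) := h.hom.hom
      obtain ⟨t, ht⟩ := ((presentedBy_iff_isPresented X _).1 Y.property).exists_comp_eq
        h'.toAddMonoidHom fun b x => h'.map_smul (MulOpposite.op b) x
      exact ⟨ObjectProperty.homMk t, FGModuleCat.hom_ext (LinearMap.ext ht)⟩⟩
  have hs : (presentedHomFunctor k X).EssSurj :=
    ⟨fun M => by
      obtain ⟨Y, hY, ⟨e⟩⟩ := exists_isPresented_linearEquiv X (isNoetherian_hom k X) M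
      have := finite_hom k X Y
      exact ⟨⟨Y, (presentedBy_iff_isPresented X Y).2 hY⟩, ⟨e.toFGModuleCatIso⟩⟩⟩
  exact { }

variable {k} in
theorem IsSelfadjoint.presentedBy_obj {X : FGModuleCat.{u} A} [Projective X] [Injective X]
    (hdc : HasDoubleCentralizerProperty X) {F : FGModuleCat.{u} A ⥤ FGModuleCat.{u} A}
    (hF : IsSelfadjoint k F) (Y : FGModuleCat.{u} A) (hY : presentedBy X Y) :
    presentedBy X (F.obj Y) := by
  have := IsNoetherianRing.of_finite k A
  obtain ⟨_, -, ⟨adj⟩⟩ := hF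
  have := adj.leftAdjoint_preservesColimits.{0, 0}
  have := adj.rightAdjoint_preservesLimits.{0, 0}
  have : PreservesFiniteColimits F := PreservesColimitsOfSize.preservesFiniteColimits.{0, 0} F
  have : PreservesFiniteLimits F := PreservesLimitsOfSize.preservesFiniteLimits.{0, 0} F
  obtain ⟨X₀, X₁, a, α, w, h₀, h₁, _, -⟩ := hdc.exists_exact
  rw [presentedBy_iff_isPresented] at hY ⊢
  have : Projective (F.obj X) := adj.map_projective X inferInstance
  have : Injective (F.obj X) := adj.map_injective X inferInstance
  exact hY.map F (isSummand_of_projective_of_injective isFiniteGenerator_regular h₀ a)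

theorem isSelfadjoint_bar (X : FGModuleCat.{u} A) [(presentedHomFunctor k X).IsEquivalence]
    {F : FGModuleCat.{u} A ⥤ FGModuleCat.{u} A} (hF : IsSelfadjoint k F)
    (hpres : ∀ Y, presentedBy X Y → presentedBy X (F.obj Y)) :
    IsSelfadjoint k (bar k X F hpres) := by
  obtain ⟨_, _, ⟨adj⟩⟩ := hF
  let Φ := presentedHomFunctor k X
  let e := Φ.asEquivalence
  have : e.functor.Additive := inferInstanceAs Φ.Additive
  have : e.functor.Linear k := inferInstanceAs (Φ.Linear k)
  have : Φ.inv.Additive := inferInstanceAs e.inverse.Additive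
  have : Φ.inv.Linear k := inferInstanceAs (e.inverse.Linear k)
  have : (restrict (presentedBy X) F hpres).Additive :=
    ⟨fun {_ _ f g} => ObjectProperty.hom_ext _ (F.map_add (f := f.hom) (g := g.hom))⟩
  have : (restrict (presentedBy X) F hpres).Linear k :=
    ⟨fun f r => ObjectProperty.hom_ext _ (Functor.map_smul F r f.hom)⟩
  refine ⟨inferInstanceAs (Φ.inv ⋙ restrict (presentedBy X) F hpres ⋙ Φ).Additive,
    inferInstanceAs ((Φ.inv ⋙ restrict (presentedBy X) F hpres ⋙ Φ).Linear k), ⟨?_⟩⟩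
  let adj' : restrict (presentedBy X) F hpres ⊣ restrict (presentedBy X) F hpres :=
    adj.restrictFullyFaithful (presentedBy X).fullyFaithfulι (presentedBy X).fullyFaithfulι
      (Iso.refl _) (Iso.refl _)
  -- Compose `Φ⁻¹ ⊣ Φ`, the restricted adjunction and `Φ ⊣ Φ⁻¹`; the two sides differ only in
  -- bracketing.
  exact (e.symm.toAdjunction.comp (adj'.comp e.toAdjunction)).ofNatIsoRight
    (Functor.associator _ _ _)

variable {k}

theorem barFunctor_full_faithful (X : FGModuleCat.{u} A)
    [(presentedHomFunctor k X).IsEquivalence] [Injective X] (hdc : HasDoubleCentralizerProperty X)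
    (hpres : ∀ F : SelfadjointEndofunctor k (FGModuleCat.{u} A),
      ∀ Y, presentedBy X Y → presentedBy X (F.obj.obj Y))
    (hself : ∀ F : SelfadjointEndofunctor k (FGModuleCat.{u} A),
      IsSelfadjoint k (bar k X F.obj (hpres F))) :
    (barFunctor k X hpres hself).Full ∧ (barFunctor k X hpres hself).Faithful := by
  have := IsNoetherianRing.of_finite k A
  let Φ := presentedHomFunctor k X
  have hfin (F : SelfadjointEndofunctor k (FGModuleCat.{u} A)) :
      F.obj.Additive ∧ PreservesFiniteColimits F.obj ∧ PreservesFiniteLimits F.obj := by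
    obtain ⟨h, -, ⟨adj⟩⟩ := F.property
    have := adj.leftAdjoint_preservesColimits.{0, 0}
    have := adj.rightAdjoint_preservesLimits.{0, 0}
    exact ⟨h, PreservesColimitsOfSize.preservesFiniteColimits.{0, 0} _,
      PreservesLimitsOfSize.preservesFiniteLimits.{0, 0} _⟩
  have : Projective (FGModuleCat.of A A) := projective_regular
  have hP := isFiniteGenerator_regular (A := A)
  obtain ⟨X₀, X₁, a, α, w, h₀, h₁, _, hex⟩ := hdc.exists_exact
  constructor
  · refine ⟨fun {F G} η => ?_⟩
    obtain ⟨_, _, _⟩ := hfin F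
    obtain ⟨_, _, _⟩ := hfin G
    let RF := restrict (presentedBy X) F.obj (hpres F)
    let RG := restrict (presentedBy X) G.obj (hpres G)
    let η' : Φ.inv ⋙ RF ⋙ Φ ⟶ Φ.inv ⋙ RG ⋙ Φ := η.hom
    -- Whiskering with an equivalence is full on either side, so `η` comes from some `ζ` between the
    -- restrictions.
    obtain ⟨η₁, h₁'⟩ := ((Functor.whiskeringLeft _ _ _).obj Φ.inv).map_surjective η'
    obtain ⟨ζ, hζ⟩ := ((Functor.whiskeringRight _ _ _).obj Φ).map_surjective η₁
    obtain ⟨ξ, hξ⟩ := exists_natTrans_extending hP h₀ h₁ a α w hex F.obj G.obj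
      (fun Y hY => (ζ.app ⟨Y, (presentedBy_iff_isPresented X Y).2 hY⟩).hom)
      (fun Y Z hY hZ f => congrArg (fun t => t.hom)
        (ζ.naturality (X := ⟨Y, (presentedBy_iff_isPresented X Y).2 hY⟩)
          (Y := ⟨Z, (presentedBy_iff_isPresented X Z).2 hZ⟩) (ObjectProperty.homMk f)))
    refine ⟨ObjectProperty.homMk ξ, ?_⟩
    have e : restrictMap (presentedBy X) (hpres F) (hpres G) ξ = ζ := by
      ext Y : 2
      exact ObjectProperty.hom_ext _ (hξ Y.obj ((presentedBy_iff_isPresented X _).1 Y.property))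
    refine ObjectProperty.hom_ext _ ?_
    change Functor.whiskerLeft Φ.inv (Functor.whiskerRight
      (restrictMap (presentedBy X) (hpres F) (hpres G) ξ) Φ) = η'
    rw [e, ← h₁', ← hζ]
    rfl
  · refine ⟨fun {F G} ξ η h => ?_⟩
    obtain ⟨_, _, _⟩ := hfin F
    obtain ⟨_, _, _⟩ := hfin G
    have h' : Functor.whiskerLeft Φ.inv (Functor.whiskerRight
        (restrictMap (presentedBy X) (hpres F) (hpres G) ξ.hom) Φ) =
        Functor.whiskerLeft Φ.inv (Functor.whiskerRight
        (restrictMap (presentedBy X) (hpres F) (hpres G) η.hom) Φ) := congrArg (fun t => t.hom) h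
    have e : restrictMap (presentedBy X) (hpres F) (hpres G) ξ.hom =
        restrictMap (presentedBy X) (hpres F) (hpres G) η.hom :=
      ((Functor.whiskeringRight _ _ _).obj Φ).map_injective
        (((Functor.whiskeringLeft _ _ _).obj Φ.inv).map_injective h')
    have hX : presentedBy X X :=
      (presentedBy_iff_isPresented X X).2 (IsSummand.refl X).isPresented
    exact ObjectProperty.hom_ext _ (natTrans_eq_of_app_eq hP h₀ a
      (congrArg (fun t => (t.app ⟨X, hX⟩).hom) e))

end Modules

end SelfadjointRestriction

open SelfadjointRestriction in
theorem mainTheorem6 {k : Type w} [Field k] {A : Type u} [Ring A] [Algebra k A]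
    [Module.Finite k A] (X : FGModuleCat.{u} A) (hproj : Projective X) (hinj : Injective X)
    (hdc : HasDoubleCentralizerProperty X) :
    ∃ (_ : (presentedHomFunctor k X).IsEquivalence)
      (hpres : ∀ F : SelfadjointEndofunctor k (FGModuleCat.{u} A),
        ∀ Y, presentedBy X Y → presentedBy X (F.obj.obj Y))
      (hself : ∀ F : SelfadjointEndofunctor k (FGModuleCat.{u} A),
        IsSelfadjoint k (bar k X F.obj (hpres F))),
      (barFunctor k X hpres hself).Full ∧ (barFunctor k X hpres hself).Faithful := by
  have := isEquivalence_presentedHomFunctor k X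
  have hpres (F : SelfadjointEndofunctor k (FGModuleCat.{u} A)) := F.property.presentedBy_obj hdc
  have hself (F : SelfadjointEndofunctor k (FGModuleCat.{u} A)) :=
    isSelfadjoint_bar k X F.property (hpres F)
  exact ⟨this, hpres, hself, barFunctor_full_faithful X hdc hpres hself⟩
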